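/- Let $N,m\ge 1$ be integers and let $H\in\mathbb{C}^{N\times N}$ be a Hermitian negative definite matrix with eigenvalues $\lambda_1\le\lambda_2\le\dots\le\lambda_N<0$ (with multiplicity). For $X\in\mathbb{C}^{N\times m}$ put $$E_0(X)=\operatorname{tr}\bigl[(2I-X^*X)X^*HX\bigr],\qquad \|X\|_1=\sum_{i,j}|X_{ij}|,\qquad E_\mu(X)=E_0(X)+\mu\|X\|_1 ,$$ let $\|X\|_0$ be the number of nonzero entries of $X$ and $\|X\|_F$ its Frobenius norm, and let $S_0$ and $S_\mu$ be the sets of global minimizers over $\mathbb{C}^{N\times m}$ of $E_0$ and of $E_\mu$. For $X\in\mathbb{C}^{N\times m}$ let $\mathcal{N}(X)=\operatorname{argmin}_{G\in S_0}\|X-G\|_F$. Let $\alpha\in(0,1)$. 1. For all $\mu>0$ the minima below are attained, and $$\min E_\mu-\min E_0\le \mu\min_{X_0\in S_0}\|X_0\|_1 .$$ 2. If $1\le m<N$ and $\lambda_m<\lambda_{m+1}$, then there is $\mu_0>0$ (which may depend on $\alpha$, $H$ and $m$) such that for all $0<\mu<\mu_0$ and all $X_\mu\in S_\mu$, $$E_0(X_\mu)-\min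 E_0\le\frac{\mu^2}{\alpha(\lambda_{m+1}-\lambda_m)}\cdot\min\bigl\{\|X_0-X_\mu\|_0 : X_0\in\mathcal{N}(X_\mu)\bigr\}\le\frac{\mu^2Nm}{\alpha(\lambda_{m+1}-\lambda_m)},$$ where the minimum over $\mathcal{N}(X_\mu)$ is attained. Consequently also $$E_0(X_\mu)-\min E_0\le\frac{\mu^2}{\alpha(\lambda_{m+1}-\lambda_m)}\cdot\min\bigl\{\|X_0-X_\mu\|_0^2 : X_0\in\mathcal{N}(X_\mu)\bigr\}.$$ -/

import Mathlib

open scoped ComplexOrder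

namespace OMM

open Matrix

/-- The set of minimizers of `f` on `s`. -/
def argminOn {β : Type*} (f : β → ℝ) (s : Set β) : Set β :=
  {x | x ∈ s ∧ IsMinOn f s x}

/-- The eigenvalues, with multiplicity, of a Hermitian `N × N` matrix in increasing order;
index `i` is 0-based, so `eigenvalueAsc hH i` is the `(i + 1)`-st smallest eigenvalue.
(Mathlib's `eigenvalues₀` lists them in decreasing order.) -/
noncomputable def eigenvalueAsc {N : ℕ} {H : Matrix (Fin N) (Fin N) ℂ}
    (hH : H.IsHermitian) (i : Fin N) : ℝ :=
  hH.eigenvalues₀ (Fin.cast (Fintype.card_fin N).symm i.rev)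

theorem eigenvalueAsc_monotone {N : ℕ} {H : Matrix (Fin N) (Fin N) ℂ}
    (hH : H.IsHermitian) : Monotone (eigenvalueAsc hH) := by
  intro i j hij
  apply hH.eigenvalues₀_antitone
  have h := Fin.rev_le_rev.2 hij
  exact h

theorem charpoly_eq_prod_eigenvalueAsc {N : ℕ} {H : Matrix (Fin N) (Fin N) ℂ}
    (hH : H.IsHermitian) :
    H.charpoly = ∏ i, (Polynomial.X - Polynomial.C (eigenvalueAsc hH i : ℂ)) := by
  rw [hH.charpoly_eq]
  let e : Fin N ≃ Fin (Fintype.card (Fin N)) :=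
    Fin.revPerm.trans (finCongr (Fintype.card_fin N).symm)
  let f : Fin (Fintype.card (Fin N)) ≃ Fin N :=
    Fintype.equivOfCardEq (Fintype.card_fin _)
  exact Fintype.prod_equiv (f.symm.trans e.symm) _ _ (fun i => by
    have : e (e.symm (f.symm i)) = f.symm i := e.apply_symm_apply _
    change _ = Polynomial.X - Polynomial.C
      ((hH.eigenvalues₀ (e (e.symm (f.symm i))) : ℝ) : ℂ)
    rw [this]
    rfl)

/-- The functional `E₀(X) = tr[(2I - X*X) X*HX]`. The trace is real when `H` is Hermitian
(see `trace_im_eq_zero`), so taking the real part only changes the type. -/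
noncomputable def E₀ {N m : ℕ} (H : Matrix (Fin N) (Fin N) ℂ)
    (X : Matrix (Fin N) (Fin m) ℂ) : ℝ :=
  (((2 : ℂ) • (1 : Matrix (Fin m) (Fin m) ℂ) - Xᴴ * X) * (Xᴴ * H * X)).trace.re

theorem trace_im_eq_zero {N m : ℕ} {H : Matrix (Fin N) (Fin N) ℂ} (hH : H.IsHermitian)
    (X : Matrix (Fin N) (Fin m) ℂ) :
    (((2 : ℂ) • (1 : Matrix (Fin m) (Fin m) ℂ) - Xᴴ * X) * (Xᴴ * H * X)).trace.im = 0 := by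
  rw [← Complex.conj_eq_iff_im, starRingEnd_apply, ← Matrix.trace_conjTranspose,
    Matrix.conjTranspose_mul, Matrix.trace_mul_comm]
  simp [Matrix.conjTranspose_mul, hH.eq, Matrix.mul_assoc]

/-- The entrywise `ℓ¹` norm. -/
noncomputable def l1 {N m : ℕ} (X : Matrix (Fin N) (Fin m) ℂ) : ℝ :=
  ∑ i, ∑ j, ‖X i j‖

/-- The number of nonzero entries. -/
noncomputable def l0 {N m : ℕ} (X : Matrix (Fin N) (Fin m) ℂ) : ℕ :=
  Set.ncard {p : Fin N × Fin m | X p.1 p.2 ≠ 0}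

/-- The Frobenius norm. -/
noncomputable def frob {N m : ℕ} (X : Matrix (Fin N) (Fin m) ℂ) : ℝ :=
  √(∑ i, ∑ j, ‖X i j‖ ^ 2)

/-- The penalized functional `E_μ(X) = E₀(X) + μ ‖X‖₁`. -/
noncomputable def E {N m : ℕ} (H : Matrix (Fin N) (Fin N) ℂ) (μ : ℝ)
    (X : Matrix (Fin N) (Fin m) ℂ) : ℝ :=
  E₀ H X + μ * l1 X

/-- The set `S₀` of global minimizers of `E₀` over all complex `N × m` matrices. -/
def S₀ {N : ℕ} (m : ℕ) (H : Matrix (Fin N) (Fin N) ℂ) : Set (Matrix (Fin N) (Fin m) ℂ) :=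
  argminOn (E₀ H) Set.univ

/-- The set `S_μ` of global minimizers of `E_μ` over all complex `N × m` matrices. -/
def S {N : ℕ} (m : ℕ) (H : Matrix (Fin N) (Fin N) ℂ) (μ : ℝ) :
    Set (Matrix (Fin N) (Fin m) ℂ) :=
  argminOn (E H μ) Set.univ

/-- The points of `S₀` closest to `X` in the Frobenius norm. -/
def nearest {N m : ℕ} (H : Matrix (Fin N) (Fin N) ℂ) (X : Matrix (Fin N) (Fin m) ℂ) :
    Set (Matrix (Fin N) (Fin m) ℂ) :=
  argminOn (fun G => frob (X - G)) (S₀ m H)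

end OMM

/-! Diagonalize `H` by a unitary `T`, put `Y = Tᴴ * X` and let `a i > 0` be the negated eigenvalues.
Then `E₀ H X` is `tr H` plus the squared Frobenius norm of `1 - Y * Yᴴ` with row `i` weighted by `a
i` (`E₀_eq_residual`). This is coercive, so all minima exist.

Split `Y` into its first `m` rows `C` and the remaining rows `B`. As `Y * Yᴴ` has rank at most `m`,
comparison with the projection onto the range of `Y` shows that the residual is least for `C`
unitary, `B = 0`, and that a small excess forces `Cᴴ * C` close to `1` (`residual_lower_bound`). In
that region the excess dominates `‖1 - Cᴴ * C‖²` and `‖B‖²` (`residual_quadratic_growth`), which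
together bound the squared distance from `X` to the minimizer built from the unitary polar factor of
`C` (`exists_unitary_near`). Hence `E₀` grows quadratically off `S₀`, with constant `g = α *
(λ_{m+1} - λ_m)` for small excess.

For a minimizer `Xμ` of `E H μ` with excess `δ` and a nearest `X₀` in `S₀`, minimality gives `δ ≤ μ
* l1 (X₀ - Xμ)`. Cauchy–Schwarz on the support and quadratic growth give `l1 (X₀ - Xμ) ^ 2 ≤ k * δ /
g`, with `k` the number of nonzero entries. Squaring and cancelling one factor `δ` finishes the
proof. -/

namespace OMM

open Matrix

/-! ### Frobenius norm identities -/

section Frobenius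

variable {ι κ : Type*} [Fintype ι] [Fintype κ]

/-- The squared Frobenius norm. -/
noncomputable def frobSq (X : Matrix ι κ ℂ) : ℝ := ∑ i, ∑ j, ‖X i j‖ ^ 2

theorem frobSq_nonneg (X : Matrix ι κ ℂ) : 0 ≤ frobSq X :=
  Finset.sum_nonneg fun _ _ => Finset.sum_nonneg fun _ _ => sq_nonneg _

theorem frobSq_conjTranspose (X : Matrix ι κ ℂ) : frobSq Xᴴ = frobSq X := by
  unfold frobSq
  rw [Finset.sum_comm]
  simp [conjTranspose_apply]

omit [Fintype ι] in
theorem mul_conjTranspose_diag_re (X : Matrix ι κ ℂ) (i : ι) :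
    ((X * Xᴴ) i i).re = ∑ j, ‖X i j‖ ^ 2 := by
  simp only [mul_apply, conjTranspose_apply, Complex.re_sum]
  refine Finset.sum_congr rfl fun j _ => ?_
  rw [Complex.star_def, Complex.mul_conj, Complex.ofReal_re, Complex.normSq_eq_norm_sq]

theorem frobSq_eq_trace (X : Matrix ι κ ℂ) : frobSq X = (X * Xᴴ).trace.re := by
  simp only [trace, diag_apply, Complex.re_sum, mul_conjTranspose_diag_re, frobSq]

theorem frobSq_eq_trace' (X : Matrix ι κ ℂ) : frobSq X = (Xᴴ * X).trace.re := by
  rw [trace_mul_comm, frobSq_eq_trace]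

theorem frobSq_isometry_mul {ι' : Type*} [Fintype ι'] [DecidableEq ι] {T : Matrix ι' ι ℂ}
    (hT : Tᴴ * T = 1) (X : Matrix ι κ ℂ) : frobSq (T * X) = frobSq X := by
  rw [frobSq_eq_trace', frobSq_eq_trace', conjTranspose_mul, Matrix.mul_assoc,
    ← Matrix.mul_assoc Tᴴ, hT, Matrix.one_mul]

theorem frobSq_mul_unitary [DecidableEq κ] {Q : Matrix κ κ ℂ}
    (hQ : Q * Qᴴ = 1) (X : Matrix ι κ ℂ) : frobSq (X * Q) = frobSq X := by
  rw [frobSq_eq_trace, frobSq_eq_trace, conjTranspose_mul, Matrix.mul_assoc,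
    ← Matrix.mul_assoc Q, hQ, Matrix.one_mul]

theorem frobSq_diagonal [DecidableEq ι] (s : ι → ℂ) :
    frobSq (diagonal s) = ∑ i, ‖s i‖ ^ 2 := by
  refine Finset.sum_congr rfl fun i _ => ?_
  rw [Finset.sum_eq_single i]
  · simp
  · intro j _ hj
    simp [diagonal_apply_ne _ hj.symm]
  · simp

/-- Both sides depend only on traces of powers of the two Gram matrices, and these agree by
cyclicity. -/
theorem frobSq_one_sub_gram_comm [DecidableEq ι] (C : Matrix ι ι ℂ) :
    frobSq (1 - C * Cᴴ) = frobSq (1 - Cᴴ * C) := by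
  rw [frobSq_eq_trace, frobSq_eq_trace]
  have h1 : (1 - C * Cᴴ) * (1 - C * Cᴴ)ᴴ
      = 1 - C * Cᴴ - C * Cᴴ + C * (Cᴴ * C * Cᴴ) := by
    simp only [conjTranspose_sub, conjTranspose_one, conjTranspose_mul,
      conjTranspose_conjTranspose]
    noncomm_ring
  have h2 : (1 - Cᴴ * C) * (1 - Cᴴ * C)ᴴ
      = 1 - Cᴴ * C - Cᴴ * C + (Cᴴ * C * Cᴴ) * C := by
    simp only [conjTranspose_sub, conjTranspose_one, conjTranspose_mul,
      conjTranspose_conjTranspose]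
    noncomm_ring
  rw [h1, h2, trace_add, trace_add, trace_sub, trace_sub, trace_sub, trace_sub,
    trace_mul_comm C Cᴴ, trace_mul_comm C (Cᴴ * C * Cᴴ)]

end Frobenius

/-! ### Range projection and polar factor -/

section Spectral

variable {ι κ : Type*} [Fintype ι] [Fintype κ] [DecidableEq κ]

/-- Right multiplication by a suitable unitary makes the columns orthogonal. -/
theorem exists_unitary_gram_diagonal (X : Matrix ι κ ℂ) :
    ∃ (Q : Matrix κ κ ℂ) (s : κ → ℝ), Qᴴ * Q = 1 ∧ Q * Qᴴ = 1 ∧ (∀ k, 0 ≤ s k) ∧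
      (X * Q)ᴴ * (X * Q) = diagonal fun k => (s k : ℂ) := by
  have hG := isHermitian_conjTranspose_mul_self X
  have hP := posSemidef_conjTranspose_mul_self X
  have h1 : (hG.eigenvectorUnitary : Matrix κ κ ℂ)ᴴ * hG.eigenvectorUnitary = 1 :=
    Unitary.coe_star_mul_self hG.eigenvectorUnitary
  have h2 : (hG.eigenvectorUnitary : Matrix κ κ ℂ) * (hG.eigenvectorUnitary : Matrix κ κ ℂ)ᴴ = 1 :=
    Unitary.coe_mul_star_self hG.eigenvectorUnitary
  refine ⟨(hG.eigenvectorUnitary : Matrix κ κ ℂ), hG.eigenvalues, h1, h2, hP.eigenvalues_nonneg, ?_⟩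
  have h3 := hG.spectral_theorem
  rw [Unitary.conjStarAlgAut_apply] at h3
  set Q : Matrix κ κ ℂ := (hG.eigenvectorUnitary).1
  have h4 : (X * Q)ᴴ * (X * Q) = Qᴴ * (Xᴴ * X) * Q := by
    simp only [conjTranspose_mul, Matrix.mul_assoc]
  have h5 := congrArg (fun M => Qᴴ * M * Q) h3
  rw [star_eq_conjTranspose] at h5
  refine (h4.trans h5).trans ?_
  calc _ = (Qᴴ * Q) * diagonal (RCLike.ofReal ∘ hG.eigenvalues) * (Qᴴ * Q) := by
        simp only [Matrix.mul_assoc]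
    _ = _ := by rw [h1, Matrix.one_mul, Matrix.mul_one]; rfl

omit [Fintype κ] in
theorem col_eq_zero_of_gram_diagonal {X : Matrix ι κ ℂ} {s : κ → ℝ}
    (h : Xᴴ * X = diagonal fun k => (s k : ℂ)) {k : κ} (hk : s k = 0) (i : ι) :
    X i k = 0 := by
  have h1 := mul_conjTranspose_diag_re Xᴴ k
  rw [conjTranspose_conjTranspose, h, diagonal_apply_eq, Complex.ofReal_re, hk] at h1
  have h2 := (Finset.sum_eq_zero_iff_of_nonneg (fun j _ => sq_nonneg ‖Xᴴ k j‖)).1 h1.symm i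
    (Finset.mem_univ _)
  simpa [conjTranspose_apply] using h2

/-- The orthogonal projection onto the column space. -/
theorem exists_range_projection [DecidableEq ι] (X : Matrix ι κ ℂ) :
    ∃ P : Matrix ι ι ℂ, Pᴴ = P ∧ P * P = P ∧ P * X = X ∧ P.trace.re ≤ Fintype.card κ := by
  obtain ⟨Q, s, hQ, hQ', hs, hG⟩ := exists_unitary_gram_diagonal X
  set Y := X * Q with hY
  -- Inverse singular values, zero where the singular value vanishes: `Y * diagonal r` is then a
  -- partial isometry with the column space of `X`.
  set r : κ → ℂ := fun k => if s k = 0 then 0 else ((1 / √(s k) : ℝ) : ℂ) with hr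
  have hr_star : (diagonal r)ᴴ = diagonal r := by
    rw [diagonal_conjTranspose]
    congr 1
    ext k
    simp only [hr, Pi.star_apply]
    split_ifs
    · simp
    · rw [Complex.star_def, Complex.conj_ofReal]
  set o : κ → ℂ := fun k => if s k = 0 then 0 else 1 with ho
  have hrr : ∀ k, r k * (s k : ℂ) * r k = o k := by
    intro k
    simp only [hr, ho]
    split_ifs with h
    · simp
    · have h0 : 0 < s k := lt_of_le_of_ne (hs k) (Ne.symm h)
      have h1 : √(s k) ≠ 0 := (Real.sqrt_pos.2 h0).ne'
      rw [← Complex.ofReal_mul, ← Complex.ofReal_mul, ← Complex.ofReal_one]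
      congr 1
      field_simp
      rw [Real.sq_sqrt h0.le]
  have hYo : Y * diagonal o = Y := by
    ext i k
    rw [mul_diagonal]
    simp only [ho]
    split_ifs with h
    · rw [col_eq_zero_of_gram_diagonal hG h i, mul_zero]
    · rw [mul_one]
  set Z := Y * diagonal r with hZ
  have hZZ : Zᴴ * Z = diagonal o := by
    rw [hZ, conjTranspose_mul, hr_star, Matrix.mul_assoc, ← Matrix.mul_assoc Yᴴ, hG,
      diagonal_mul_diagonal, diagonal_mul_diagonal]
    congr 1
    ext k
    rw [← hrr k]; ring
  have hZo : Z * diagonal o = Z := by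
    rw [hZ, Matrix.mul_assoc, diagonal_mul_diagonal]
    congr 2
    ext k
    simp only [hr, ho]
    split_ifs <;> simp
  have hPY : Z * Zᴴ * Y = Y := by
    have h1 : Z * Zᴴ * Y = Y * (diagonal r * (diagonal r * (Yᴴ * Y))) := by
      rw [hZ, conjTranspose_mul, hr_star]
      simp only [Matrix.mul_assoc]
    rw [h1, hG, diagonal_mul_diagonal, diagonal_mul_diagonal]
    conv_rhs => rw [← hYo]
    congr 2
    ext k
    rw [← hrr k]; ring
  refine ⟨Z * Zᴴ, by rw [conjTranspose_mul, conjTranspose_conjTranspose], ?_, ?_, ?_⟩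
  · rw [← Matrix.mul_assoc, Matrix.mul_assoc Z, hZZ, hZo]
  · have hX : X = Y * Qᴴ := by rw [hY, Matrix.mul_assoc, hQ', Matrix.mul_one]
    conv_lhs => rw [hX]
    rw [← Matrix.mul_assoc, hPY, ← hX]
  · rw [trace_mul_comm, hZZ, trace_diagonal, Complex.re_sum]
    calc ∑ k, (o k).re ≤ ∑ _k : κ, (1 : ℝ) := by
          refine Finset.sum_le_sum fun k _ => ?_
          simp only [ho]
          split_ifs <;> simp
      _ = _ := by simp

/-- A square matrix that is almost unitary is close to a unitary one. -/
theorem exists_unitary_near (C : Matrix κ κ ℂ) (hC : frobSq (1 - Cᴴ * C) < 1) :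
    ∃ U : Matrix κ κ ℂ, U * Uᴴ = 1 ∧ frobSq (C - U) ≤ frobSq (1 - Cᴴ * C) := by
  obtain ⟨Q, s, hQ, hQ', hs, hG⟩ := exists_unitary_gram_diagonal C
  set Y := C * Q with hY
  have hdist : frobSq (1 - Cᴴ * C) = ∑ k, (1 - s k) ^ 2 := by
    have h1 : Qᴴ * ((1 - Cᴴ * C) * Q) = diagonal fun k => ((1 - s k : ℝ) : ℂ) := by
      have : Qᴴ * ((1 - Cᴴ * C) * Q) = Qᴴ * Q - Yᴴ * Y := by
        rw [hY, conjTranspose_mul]; noncomm_ring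
      rw [this, hQ, hG, ← diagonal_one, diagonal_sub]
      congr 1
      ext k
      push_cast; rfl
    rw [← frobSq_mul_unitary hQ', ← frobSq_isometry_mul (T := Qᴴ)
      (by rwa [conjTranspose_conjTranspose]), h1, frobSq_diagonal]
    refine Finset.sum_congr rfl fun k _ => ?_
    rw [Complex.norm_real, Real.norm_eq_abs, sq_abs]
  have hpos : ∀ k, 0 < s k := by
    intro k
    have h1 : (1 - s k) ^ 2 < 1 := lt_of_le_of_lt
      (Finset.single_le_sum (f := fun k => (1 - s k) ^ 2) (fun _ _ => sq_nonneg _)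
        (Finset.mem_univ k)) (hdist ▸ hC)
    nlinarith [hs k]
  -- No singular value vanishes here, so normalizing the columns of `Y` gives a unitary; `Z * Qᴴ` is
  -- the polar factor of `C`.
  set r : κ → ℂ := fun k => ((1 / √(s k) : ℝ) : ℂ) with hr
  have hr_star : (diagonal r)ᴴ = diagonal r := by
    rw [diagonal_conjTranspose]
    congr 1
    ext k
    simp only [hr, Pi.star_apply]
    rw [Complex.star_def, Complex.conj_ofReal]
  set Z := Y * diagonal r with hZ
  have hZZ : Zᴴ * Z = 1 := by
    rw [hZ, conjTranspose_mul, hr_star, Matrix.mul_assoc, ← Matrix.mul_assoc Yᴴ, hG,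
      diagonal_mul_diagonal, diagonal_mul_diagonal, ← diagonal_one]
    congr 1
    ext k
    simp only [hr]
    have h1 : √(s k) ≠ 0 := (Real.sqrt_pos.2 (hpos k)).ne'
    rw [← Complex.ofReal_mul, ← Complex.ofReal_mul, ← Complex.ofReal_one]
    congr 1
    field_simp
    rw [Real.sq_sqrt (hs k)]
  have hZZ' : Z * Zᴴ = 1 := mul_eq_one_comm.1 hZZ
  refine ⟨Z * Qᴴ, ?_, ?_⟩
  · rw [conjTranspose_mul, conjTranspose_conjTranspose, Matrix.mul_assoc, ← Matrix.mul_assoc Qᴴ,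
      hQ, Matrix.one_mul, hZZ']
  · have hYZ : Y = Z * diagonal fun k => ((√(s k) : ℝ) : ℂ) := by
      rw [hZ, Matrix.mul_assoc, diagonal_mul_diagonal]
      conv_lhs => rw [← Matrix.mul_one Y, ← diagonal_one]
      congr 2
      ext k
      simp only [hr]
      have h1 : √(s k) ≠ 0 := (Real.sqrt_pos.2 (hpos k)).ne'
      rw [← Complex.ofReal_mul, ← Complex.ofReal_one]
      congr 1
      field_simp
    have h1 : (C - Z * Qᴴ) * Q = Z * diagonal fun k => ((√(s k) - 1 : ℝ) : ℂ) := by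
      rw [Matrix.sub_mul, ← hY, Matrix.mul_assoc, hQ, hYZ, ← Matrix.mul_sub, ← diagonal_one,
        diagonal_sub]
      congr 2
      ext k
      push_cast; rfl
    rw [← frobSq_mul_unitary hQ', h1, frobSq_isometry_mul hZZ, frobSq_diagonal, hdist]
    refine Finset.sum_le_sum fun k _ => ?_
    rw [Complex.norm_real, Real.norm_eq_abs, sq_abs]
    have h2 := Real.sq_sqrt (hs k)
    have h3 := Real.sqrt_nonneg (s k)
    generalize √(s k) = x at *
    rw [← h2]
    -- For a singular value `x ≥ 0`, `|1 - x ^ 2| = |1 - x| * (1 + x) ≥ |1 - x|`.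
    have h4 : (1 - x ^ 2) ^ 2 - (x - 1) ^ 2 = (x - 1) ^ 2 * (x * (x + 2)) := by ring
    nlinarith [mul_nonneg (sq_nonneg (x - 1)) (mul_nonneg h3 (by linarith : (0:ℝ) ≤ x + 2))]

end Spectral

/-! ### The weighted residual -/

section Residual

variable {ι κ : Type*} [Fintype ι] [Fintype κ] [DecidableEq ι]

/-- The weighted squared Frobenius norm of `1 - Y Yᴴ`, row `i` having weight `a i`. -/
noncomputable def residual (a : ι → ℝ) (Y : Matrix ι κ ℂ) : ℝ :=
  ∑ i, a i * ∑ j, ‖(1 - Y * Yᴴ : Matrix ι ι ℂ) i j‖ ^ 2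

theorem E₀_eq_residual {N m : ℕ} {H : Matrix (Fin N) (Fin N) ℂ} {T : Matrix (Fin N) ι ℂ}
    {a : ι → ℝ} (hT : Tᴴ * T = 1) (hT' : T * Tᴴ = 1)
    (hH : H = -(T * diagonal (fun i => (a i : ℂ)) * Tᴴ)) (X : Matrix (Fin N) (Fin m) ℂ) :
    E₀ H X = H.trace.re + residual a (Tᴴ * X) := by
  set Y := Tᴴ * X with hY
  set D : Matrix ι ι ℂ := diagonal fun i => (a i : ℂ) with hD
  have hXY : Xᴴ * X = Yᴴ * Y := by
    rw [hY, conjTranspose_mul, conjTranspose_conjTranspose, Matrix.mul_assoc,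
      ← Matrix.mul_assoc T, hT', Matrix.one_mul]
  have hXH : Xᴴ * H * X = -(Yᴴ * D * Y) := by
    rw [hH, hY, conjTranspose_mul, conjTranspose_conjTranspose]
    simp only [Matrix.mul_neg, Matrix.neg_mul, Matrix.mul_assoc]
  have hres : residual a Y = (D * ((1 - Y * Yᴴ) * (1 - Y * Yᴴ)ᴴ)).trace.re := by
    simp only [trace, diag_apply, Complex.re_sum, hD, diagonal_mul, residual,
      Complex.re_ofReal_mul, mul_conjTranspose_diag_re]
  have htr : H.trace = -D.trace := by
    rw [hH, trace_neg, trace_mul_comm, ← Matrix.mul_assoc, hT, Matrix.one_mul]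
  have h1 : D * ((1 - Y * Yᴴ) * (1 - Y * Yᴴ)ᴴ)
      = D - (D * Y) * Yᴴ - (D * Y) * Yᴴ + (D * Y) * (Yᴴ * Y * Yᴴ) := by
    simp only [conjTranspose_sub, conjTranspose_one, conjTranspose_mul,
      conjTranspose_conjTranspose]
    simp only [Matrix.mul_sub, Matrix.sub_mul, Matrix.mul_one, Matrix.one_mul, Matrix.mul_assoc]
    abel
  have h2 : ((2 : ℂ) • (1 : Matrix (Fin m) (Fin m) ℂ) - Yᴴ * Y) * -(Yᴴ * D * Y)
      = (Yᴴ * Y * Yᴴ) * (D * Y) - Yᴴ * (D * Y) - Yᴴ * (D * Y) := by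
    rw [Matrix.sub_mul, Matrix.smul_mul, Matrix.one_mul, two_smul]
    simp only [Matrix.mul_neg, Matrix.mul_assoc]
    abel
  rw [E₀, hXY, hXH, h2, hres, h1, htr]
  simp only [trace_add, trace_sub]
  rw [trace_mul_comm (D * Y), trace_mul_comm (D * Y)]
  simp only [Complex.add_re, Complex.sub_re, Complex.neg_re]
  ring

/-- Pythagoras row by row: in `1 - Y * Yᴴ = (1 - P) + (P - Y * Yᴴ)` the cross terms vanish because
`P` fixes `Y`, and the rows of the projection `1 - P` have squared norms equal to its diagonal
entries. -/
theorem residual_eq_of_projection (a : ι → ℝ) {Y : Matrix ι κ ℂ} {P : Matrix ι ι ℂ}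
    (hP : Pᴴ = P) (hP2 : P * P = P) (hPY : P * Y = Y) :
    residual a Y = ∑ i, a i * (1 - (P i i).re) + ∑ i, a i * ∑ j, ‖(P - Y * Yᴴ) i j‖ ^ 2 := by
  have hYP : Yᴴ * P = Yᴴ := by
    rw [← hP, ← conjTranspose_mul, hPY]
  have h1 : (1 - Y * Yᴴ) * (1 - Y * Yᴴ)ᴴ
      = (1 - P) + (P - Y * Yᴴ) * (P - Y * Yᴴ)ᴴ := by
    simp only [conjTranspose_sub, conjTranspose_one, conjTranspose_mul,
      conjTranspose_conjTranspose, hP]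
    rw [Matrix.sub_mul P, Matrix.mul_sub P, hP2, ← Matrix.mul_assoc P, hPY, Matrix.mul_sub (Y * Yᴴ),
      Matrix.mul_assoc Y Yᴴ P, hYP]
    noncomm_ring
  rw [residual, ← Finset.sum_add_distrib]
  refine Finset.sum_congr rfl fun i _ => ?_
  rw [← mul_conjTranspose_diag_re, h1, ← mul_conjTranspose_diag_re]
  simp only [Matrix.add_apply, Matrix.sub_apply, one_apply_eq, Complex.add_re, Complex.sub_re, Complex.one_re]
  ring

/-- The diagonal suffices: with `x` the modulus of the `i`-th diagonal entry of `1 - Y * Yᴴ`, row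
`i` of `Y` has squared norm at most `1 + x ≤ 2 + x ^ 2`. -/
theorem residual_coercive {a : ι → ℝ} {c : ℝ} (hc : 0 < c) (ha : ∀ i, c ≤ a i)
    (Y : Matrix ι κ ℂ) : frobSq Y ≤ Fintype.card ι * (2 + residual a Y / c) := by
  have hrow : ∀ i, ∑ j, ‖Y i j‖ ^ 2 ≤ 2 + residual a Y / c := by
    intro i
    rw [← mul_conjTranspose_diag_re]
    have h1 : ‖(1 - Y * Yᴴ : Matrix ι ι ℂ) i i‖ ^ 2 ≤ residual a Y / c := by
      rw [le_div_iff₀ hc, mul_comm]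
      have hj : ‖(1 - Y * Yᴴ : Matrix ι ι ℂ) i i‖ ^ 2 ≤ ∑ j, ‖(1 - Y * Yᴴ : Matrix ι ι ℂ) i j‖ ^ 2 :=
        Finset.single_le_sum (f := fun j => ‖(1 - Y * Yᴴ : Matrix ι ι ℂ) i j‖ ^ 2)
          (fun _ _ => sq_nonneg _) (Finset.mem_univ i)
      refine le_trans (mul_le_mul (ha i) hj (sq_nonneg _) (hc.le.trans (ha i))) ?_
      exact Finset.single_le_sum (f := fun i => a i * ∑ j, ‖(1 - Y * Yᴴ : Matrix ι ι ℂ) i j‖ ^ 2)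
        (fun i _ => mul_nonneg (hc.le.trans (ha i))
          (Finset.sum_nonneg fun _ _ => sq_nonneg _)) (Finset.mem_univ i)
    have h2 : |1 - ((Y * Yᴴ) i i).re| ≤ ‖(1 - Y * Yᴴ : Matrix ι ι ℂ) i i‖ := by
      have := Complex.abs_re_le_norm ((1 - Y * Yᴴ : Matrix ι ι ℂ) i i)
      simpa only [Matrix.sub_apply, one_apply_eq, Complex.sub_re, Complex.one_re] using this
    have h3 := neg_abs_le (1 - ((Y * Yᴴ) i i).re)
    nlinarith [sq_nonneg (‖(1 - Y * Yᴴ : Matrix ι ι ℂ) i i‖ - 1)]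
  calc frobSq Y ≤ ∑ _i : ι, (2 + residual a Y / c) := Finset.sum_le_sum fun i _ => hrow i
    _ = _ := by simp [mul_add]

end Residual

/-! ### Block estimates: lower bound and quadratic growth -/

section Block

variable {p q : Type*} [Fintype p] [Fintype q] [DecidableEq p] [DecidableEq q]

omit [DecidableEq p] [DecidableEq q] in
theorem frobSq_fromRows {κ : Type*} [Fintype κ] (C : Matrix p κ ℂ) (B : Matrix q κ ℂ) :
    frobSq (fromRows C B) = frobSq C + frobSq B := by
  simp [frobSq, Fintype.sum_sum_type]

theorem residual_fromRows (a : p → ℝ) (b : q → ℝ) (C : Matrix p p ℂ) (B : Matrix q p ℂ) :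
    residual (Sum.elim a b) (fromRows C B)
      = ∑ i, a i * (∑ j, ‖(1 - C * Cᴴ : Matrix p p ℂ) i j‖ ^ 2 + ∑ j, ‖(C * Bᴴ) i j‖ ^ 2)
        + ∑ i, b i * (∑ j, ‖(B * Cᴴ) i j‖ ^ 2 + ∑ j, ‖(1 - B * Bᴴ : Matrix q q ℂ) i j‖ ^ 2) := by
  have h : (1 : Matrix (p ⊕ q) (p ⊕ q) ℂ) - fromRows C B * (fromRows C B)ᴴ
      = fromBlocks (1 - C * Cᴴ) (-(C * Bᴴ)) (-(B * Cᴴ)) (1 - B * Bᴴ) := by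
    rw [conjTranspose_fromRows_eq_fromCols_conjTranspose, fromRows_mul_fromCols, ← fromBlocks_one,
      sub_eq_add_neg, fromBlocks_neg, fromBlocks_add]
    simp [sub_eq_add_neg]
  simp only [residual, h, Fintype.sum_sum_type, Sum.elim_inl, Sum.elim_inr, fromBlocks_apply₁₁,
    fromBlocks_apply₁₂, fromBlocks_apply₂₁, fromBlocks_apply₂₂, Matrix.neg_apply, norm_neg]

theorem residual_unitary (a : p → ℝ) (b : q → ℝ) {U : Matrix p p ℂ} (hU : U * Uᴴ = 1) :
    residual (Sum.elim a b) (fromRows U (0 : Matrix q p ℂ)) = ∑ i, b i := by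
  rw [residual_fromRows]
  have h : ∀ i : q, ∑ j, ‖(1 : Matrix q q ℂ) i j‖ ^ 2 = 1 := by
    intro i
    rw [Finset.sum_eq_single i]
    · simp
    · intro j _ hj
      simp [one_apply_ne hj.symm]
    · simp
  simp [hU, h]

/-- The residual exceeds its minimum by a multiple of the deviation of the leading block from
being unitary. -/
theorem residual_lower_bound {a : p → ℝ} {b : q → ℝ} {c d e : ℝ} (hc : 0 < c) (he : 0 ≤ e)
    (hde : e < d) (ha : ∀ i, d ≤ a i) (hb : ∀ j, b j ≤ e) (hca : ∀ i, c ≤ a i)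
    (hcb : ∀ j, c ≤ b j) (C : Matrix p p ℂ) (B : Matrix q p ℂ) :
    0 ≤ residual (Sum.elim a b) (fromRows C B) - ∑ j, b j ∧
    frobSq (1 - Cᴴ * C) ≤
      2 * (1 / (d - e) + 1 / c) * (residual (Sum.elim a b) (fromRows C B) - ∑ j, b j) := by
  obtain ⟨P, hP, hP2, hPY, htr⟩ := exists_range_projection (fromRows C B)
  set δ := residual (Sum.elim a b) (fromRows C B) - ∑ j, b j with hδ
  set R := P - fromRows C B * (fromRows C B)ᴴ with hR
  have hdiag : ∀ i, ((1 - P) i i).re = ∑ j, ‖(1 - P) i j‖ ^ 2 := by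
    intro i
    rw [← mul_conjTranspose_diag_re]
    have : (1 - P) * (1 - P)ᴴ = 1 - P := by
      rw [conjTranspose_sub, conjTranspose_one, hP, Matrix.sub_mul, Matrix.one_mul, Matrix.mul_sub,
        Matrix.mul_one, hP2, sub_self, sub_zero]
    rw [this]
  have hdiag' : ∀ i, 1 - (P i i).re = ∑ j, ‖(1 - P) i j‖ ^ 2 := by
    intro i
    rw [← hdiag]
    simp
  have hPn : ∀ i, 0 ≤ (P i i).re := by
    intro i
    have h1 := mul_conjTranspose_diag_re P i
    rw [hP, hP2] at h1
    rw [h1]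
    exact Finset.sum_nonneg fun _ _ => sq_nonneg _
  set t := ∑ i : p, (1 - (P (.inl i) (.inl i)).re) with ht
  have ht0 : 0 ≤ t := Finset.sum_nonneg fun i _ => by
    rw [hdiag']; exact Finset.sum_nonneg fun _ _ => sq_nonneg _
  -- The trace of `P` is at most the size of the leading block, so what `P` puts on the trailing
  -- block is at most the deficit `t` in the leading one.
  have htq : ∑ j : q, (P (.inr j) (.inr j)).re ≤ t := by
    simp only [trace, diag_apply, Fintype.sum_sum_type, Complex.add_re, Complex.re_sum] at htr
    simp only [ht, Finset.sum_sub_distrib, Finset.sum_const, Finset.card_univ, nsmul_eq_mul,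
      mul_one]
    linarith
  -- The deficit costs at least `d` per unit in the leading block and regains at most `e` per unit
  -- in the trailing one.
  have hmain : (d - e) * t + c * frobSq R ≤ δ := by
    have h1 : d * t ≤ ∑ i : p, a i * (1 - (P (.inl i) (.inl i)).re) := by
      rw [ht, Finset.mul_sum]
      refine Finset.sum_le_sum fun i _ => mul_le_mul_of_nonneg_right (ha i) ?_
      rw [hdiag']; exact Finset.sum_nonneg fun _ _ => sq_nonneg _
    have h2 : ∑ j, b j - e * t ≤ ∑ j : q, b j * (1 - (P (.inr j) (.inr j)).re) := by
      have : ∑ j : q, b j * (P (.inr j) (.inr j)).re ≤ e * t := by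
        refine le_trans ?_ (mul_le_mul_of_nonneg_left htq he)
        rw [Finset.mul_sum]
        exact Finset.sum_le_sum fun j _ => mul_le_mul_of_nonneg_right (hb j) (hPn _)
      simp only [mul_sub, mul_one, Finset.sum_sub_distrib]
      linarith
    have h3 : c * frobSq R ≤ ∑ i, Sum.elim a b i * ∑ j, ‖R i j‖ ^ 2 := by
      rw [frobSq, Finset.mul_sum]
      refine Finset.sum_le_sum fun i _ => mul_le_mul_of_nonneg_right ?_
        (Finset.sum_nonneg fun _ _ => sq_nonneg _)
      cases i
      · exact hca _
      · exact hcb _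
    rw [hδ, residual_eq_of_projection _ hP hP2 hPY, Fintype.sum_sum_type]
    simp only [Sum.elim_inl, Sum.elim_inr]
    linarith
  have hgap : 0 < d - e := sub_pos.2 hde
  have hR0 := frobSq_nonneg R
  refine ⟨by nlinarith [mul_nonneg hgap.le ht0, mul_nonneg hc.le hR0], ?_⟩
  -- `1 - C * Cᴴ` is the leading block of `(1 - P) + R`, and the leading rows of `1 - P` have total
  -- squared norm `t`.
  have hη : frobSq (1 - Cᴴ * C) ≤ 2 * t + 2 * frobSq R := by
    rw [← frobSq_one_sub_gram_comm]
    have hentry : ∀ i j, (1 - C * Cᴴ : Matrix p p ℂ) i j = (1 - P) (.inl i) (.inl j) + R (.inl i) (.inl j) := by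
      intro i j
      rw [hR, conjTranspose_fromRows_eq_fromCols_conjTranspose, fromRows_mul_fromCols]
      simp only [Matrix.sub_apply, fromBlocks_apply₁₁, one_apply, Sum.inl.injEq]
      ring
    have h1 : frobSq (1 - C * Cᴴ) ≤ ∑ i, ∑ j, (2 * ‖(1 - P) (.inl i) (.inl j)‖ ^ 2
        + 2 * ‖R (.inl i) (.inl j)‖ ^ 2) := by
      refine Finset.sum_le_sum fun i _ => Finset.sum_le_sum fun j _ => ?_
      rw [hentry]
      have h2 := norm_add_le ((1 - P) (.inl i) (.inl j)) (R (.inl i) (.inl j))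
      have h3 := norm_nonneg ((1 - P) (.inl i) (.inl j) + R (.inl i) (.inl j))
      nlinarith [sq_nonneg (‖(1 - P) (.inl i) (.inl j)‖ - ‖R (.inl i) (.inl j)‖),
        pow_le_pow_left₀ h3 h2 2]
    have h2 : ∑ i, ∑ j, ‖(1 - P) (.inl i) (.inl j)‖ ^ 2 ≤ t := by
      refine Finset.sum_le_sum fun i _ => ?_
      rw [hdiag', Fintype.sum_sum_type]
      exact le_add_of_nonneg_right (Finset.sum_nonneg fun _ _ => sq_nonneg _)
    have h3 : ∑ i, ∑ j, ‖R (.inl i) (.inl j)‖ ^ 2 ≤ frobSq R := by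
      rw [frobSq, Fintype.sum_sum_type]
      refine le_add_of_le_of_nonneg (Finset.sum_le_sum fun i _ => ?_)
        (Finset.sum_nonneg fun _ _ => Finset.sum_nonneg fun _ _ => sq_nonneg _)
      rw [Fintype.sum_sum_type]
      exact le_add_of_nonneg_right (Finset.sum_nonneg fun _ _ => sq_nonneg _)
    simp only [Finset.sum_add_distrib, ← Finset.mul_sum] at h1
    linarith
  have h4 : t ≤ δ / (d - e) := by
    rw [le_div_iff₀ hgap]; nlinarith
  have h5 : frobSq R ≤ δ / c := by
    rw [le_div_iff₀ hc]; nlinarith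
  calc _ ≤ 2 * t + 2 * frobSq R := hη
    _ ≤ 2 * (δ / (d - e)) + 2 * (δ / c) := by linarith
    _ = _ := by ring

-- With `v` the `i`-th row of `B`, the right side is `‖v‖² - v * M * vᴴ` for `M = 1 - Cᴴ * C`, and
-- Cauchy–Schwarz over pairs of indices bounds the quadratic form by `‖M‖ * ‖v‖²` in the Frobenius
-- norm.
omit [Fintype q] [DecidableEq q] in
theorem row_mul_conjTranspose_ge (C : Matrix p p ℂ) (B : Matrix q p ℂ) (i : q) :
    (1 - √(frobSq (1 - Cᴴ * C))) * ∑ j, ‖B i j‖ ^ 2 ≤ ∑ j, ‖(B * Cᴴ) i j‖ ^ 2 := by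
  set M := 1 - Cᴴ * C with hM
  have h1 : (B * Cᴴ) * (B * Cᴴ)ᴴ = B * Bᴴ - B * M * Bᴴ := by
    rw [hM, conjTranspose_mul, conjTranspose_conjTranspose]
    simp only [Matrix.mul_sub, Matrix.sub_mul, Matrix.mul_one, Matrix.mul_assoc]
    abel
  rw [← mul_conjTranspose_diag_re (B * Cᴴ), h1, Matrix.sub_apply, Complex.sub_re,
    mul_conjTranspose_diag_re]
  have h2 : ((B * M * Bᴴ : Matrix q q ℂ) i i).re ≤ √(frobSq M) * ∑ j, ‖B i j‖ ^ 2 := by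
    have h3 : (B * M * Bᴴ : Matrix q q ℂ) i i = ∑ x : p × p, M x.2 x.1 * (B i x.2 * star (B i x.1)) := by
      rw [Fintype.sum_prod_type, mul_apply]
      refine Finset.sum_congr rfl fun k _ => ?_
      rw [mul_apply, Finset.sum_mul]
      refine Finset.sum_congr rfl fun l _ => ?_
      rw [conjTranspose_apply]
      ring
    have h4 : ((B * M * Bᴴ : Matrix q q ℂ) i i).re ≤ ∑ x : p × p, ‖M x.2 x.1‖ * (‖B i x.2‖ * ‖B i x.1‖) := by
      refine (Complex.re_le_norm _).trans ?_
      rw [h3]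
      refine (norm_sum_le _ _).trans (le_of_eq ?_)
      simp
    refine h4.trans ?_
    refine (Real.sum_mul_le_sqrt_mul_sqrt _ _ _).trans (le_of_eq ?_)
    have h5 : ∑ x : p × p, ‖M x.2 x.1‖ ^ 2 = frobSq M := by
      rw [Fintype.sum_prod_type_right]; rfl
    have h6 : ∑ x : p × p, (‖B i x.2‖ * ‖B i x.1‖) ^ 2 = (∑ j, ‖B i j‖ ^ 2) ^ 2 := by
      rw [Fintype.sum_prod_type, sq, Finset.sum_mul_sum]
      refine Finset.sum_congr rfl fun k _ => Finset.sum_congr rfl fun l _ => ?_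
      ring
    rw [h5, h6, Real.sqrt_sq (Finset.sum_nonneg fun _ _ => sq_nonneg _)]
  linarith

/-- Quadratic growth of the residual around its set of minimizers. -/
theorem residual_quadratic_growth {a : p → ℝ} {b : q → ℝ} {d e : ℝ}
    (hd : 0 ≤ d) (ha : ∀ i, d ≤ a i) (hb : ∀ j, b j ≤ e) (hb0 : ∀ j, 0 ≤ b j)
    (C : Matrix p p ℂ) (B : Matrix q p ℂ) {η : ℝ} (hη : √(frobSq (1 - Cᴴ * C)) = η) :
    ∑ j, b j + d * η ^ 2 + ((d - e) - η * (d + e)) * frobSq B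
      ≤ residual (Sum.elim a b) (fromRows C B) := by
  have hη0 : 0 ≤ η := hη ▸ Real.sqrt_nonneg _
  have hη2 : frobSq (1 - C * Cᴴ) = η ^ 2 := by
    rw [frobSq_one_sub_gram_comm, ← hη, Real.sq_sqrt (frobSq_nonneg _)]
  have hrow := row_mul_conjTranspose_ge C B
  rw [hη] at hrow
  have hCB : (1 - η) * frobSq B ≤ frobSq (C * Bᴴ) := by
    rw [← frobSq_conjTranspose (C * Bᴴ), conjTranspose_mul, conjTranspose_conjTranspose,
      frobSq, frobSq, Finset.mul_sum]
    exact Finset.sum_le_sum fun i _ => hrow i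
  have h1 : d * (η ^ 2 + (1 - η) * frobSq B)
      ≤ ∑ i, a i * (∑ j, ‖(1 - C * Cᴴ : Matrix p p ℂ) i j‖ ^ 2 + ∑ j, ‖(C * Bᴴ) i j‖ ^ 2) := by
    calc d * (η ^ 2 + (1 - η) * frobSq B) ≤ d * (frobSq (1 - C * Cᴴ) + frobSq (C * Bᴴ)) :=
          mul_le_mul_of_nonneg_left (by rw [hη2]; linarith) hd
      _ = ∑ i, d * (∑ j, ‖(1 - C * Cᴴ : Matrix p p ℂ) i j‖ ^ 2 + ∑ j, ‖(C * Bᴴ) i j‖ ^ 2) := by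
          rw [frobSq, frobSq, ← Finset.sum_add_distrib, Finset.mul_sum]
      _ ≤ _ := Finset.sum_le_sum fun i _ => mul_le_mul_of_nonneg_right (ha i)
          (add_nonneg (Finset.sum_nonneg fun _ _ => sq_nonneg _)
            (Finset.sum_nonneg fun _ _ => sq_nonneg _))
  -- With `n` the squared norm of row `i` of `B`, the diagonal entry gives `(1 - n) ^ 2 ≥ 1 - 2 * n`
  -- and the off-diagonal block adds `(1 - η) * n`: a loss of at most `(1 + η) * n`. Together with
  -- `h1`, the coefficient of `frobSq B` is `d * (1 - η) - e * (1 + η)`.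
  have h2 : ∑ j, b j - e * (1 + η) * frobSq B
      ≤ ∑ i, b i * (∑ j, ‖(B * Cᴴ) i j‖ ^ 2 + ∑ j, ‖(1 - B * Bᴴ : Matrix q q ℂ) i j‖ ^ 2) := by
    rw [frobSq, Finset.mul_sum, ← Finset.sum_sub_distrib]
    refine Finset.sum_le_sum fun i _ => ?_
    have hn : 0 ≤ ∑ j, ‖B i j‖ ^ 2 := Finset.sum_nonneg fun _ _ => sq_nonneg _
    have h3 : 1 - 2 * ∑ j, ‖B i j‖ ^ 2 ≤ ∑ j, ‖(1 - B * Bᴴ : Matrix q q ℂ) i j‖ ^ 2 := by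
      refine le_trans ?_ (Finset.single_le_sum (f := fun j => ‖(1 - B * Bᴴ : Matrix q q ℂ) i j‖ ^ 2)
        (fun _ _ => sq_nonneg _) (Finset.mem_univ i))
      have h4 := Complex.abs_re_le_norm ((1 - B * Bᴴ : Matrix q q ℂ) i i)
      rw [Matrix.sub_apply, one_apply_eq, Complex.sub_re, Complex.one_re,
        mul_conjTranspose_diag_re] at h4
      have h5 := pow_le_pow_left₀ (abs_nonneg _) h4 2
      rw [sq_abs] at h5
      simp only [Matrix.sub_apply, one_apply_eq]
      nlinarith [sq_nonneg (∑ j, ‖B i j‖ ^ 2)]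
    have h6 : b i * (1 - (1 + η) * ∑ j, ‖B i j‖ ^ 2)
        ≤ b i * (∑ j, ‖(B * Cᴴ) i j‖ ^ 2 + ∑ j, ‖(1 - B * Bᴴ : Matrix q q ℂ) i j‖ ^ 2) :=
      mul_le_mul_of_nonneg_left (by linarith [hrow i]) (hb0 i)
    have h7 : b i * ((1 + η) * ∑ j, ‖B i j‖ ^ 2) ≤ e * ((1 + η) * ∑ j, ‖B i j‖ ^ 2) :=
      mul_le_mul_of_nonneg_right (hb i) (mul_nonneg (by linarith) hn)
    linarith
  rw [residual_fromRows]
  linarith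

end Block

/-! ### Entrywise norms and continuity -/

section Norms

variable {N m : ℕ}

theorem frob_eq_sqrt (X : Matrix (Fin N) (Fin m) ℂ) : frob X = √(frobSq X) := rfl

theorem l1_nonneg (X : Matrix (Fin N) (Fin m) ℂ) : 0 ≤ l1 X :=
  Finset.sum_nonneg fun _ _ => Finset.sum_nonneg fun _ _ => norm_nonneg _

theorem l1_sub_le (X Y : Matrix (Fin N) (Fin m) ℂ) : l1 X - l1 Y ≤ l1 (X - Y) := by
  simp only [l1, ← Finset.sum_sub_distrib]
  exact Finset.sum_le_sum fun _ _ => Finset.sum_le_sum fun _ _ => norm_sub_norm_le _ _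

theorem l0_le (X : Matrix (Fin N) (Fin m) ℂ) : l0 X ≤ N * m := by
  refine (Set.ncard_le_ncard (Set.subset_univ _) Set.finite_univ).trans (le_of_eq ?_)
  rw [Set.ncard_univ, Nat.card_eq_fintype_card, Fintype.card_prod, Fintype.card_fin,
    Fintype.card_fin]

/-- Cauchy–Schwarz on the support of `X`; this is where the count of nonzero entries enters the
final bound. -/
theorem l1_sq_le (X : Matrix (Fin N) (Fin m) ℂ) : l1 X ^ 2 ≤ l0 X * frobSq X := by
  classical
  set s : Finset (Fin N × Fin m) := Finset.univ.filter fun x => X x.1 x.2 ≠ 0 with hs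
  have h0 : l0 X = s.card := by
    rw [l0, ← Set.ncard_coe_finset]
    congr 1
    ext x
    simp [hs]
  have h1 : l1 X = ∑ x ∈ s, ‖X x.1 x.2‖ := by
    rw [l1, ← Fintype.sum_prod_type' (f := fun i j => ‖X i j‖)]
    refine (Finset.sum_subset (Finset.subset_univ s) fun x _ hx => ?_).symm
    simpa [hs] using hx
  have h2 : ∑ x ∈ s, ‖X x.1 x.2‖ ^ 2 ≤ frobSq X := by
    rw [frobSq, ← Fintype.sum_prod_type' (f := fun i j => ‖X i j‖ ^ 2)]
    exact Finset.sum_le_sum_of_subset_of_nonneg (Finset.subset_univ s)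
      fun _ _ _ => sq_nonneg _
  rw [h0, h1]
  exact sq_sum_le_card_mul_sum_sq.trans (mul_le_mul_of_nonneg_left h2 (Nat.cast_nonneg _))

theorem continuous_E₀ (H : Matrix (Fin N) (Fin N) ℂ) :
    Continuous (E₀ H : Matrix (Fin N) (Fin m) ℂ → ℝ) := by
  unfold E₀
  fun_prop

theorem continuous_l1 : Continuous (l1 : Matrix (Fin N) (Fin m) ℂ → ℝ) := by
  unfold l1
  fun_prop

theorem continuous_frob : Continuous (frob : Matrix (Fin N) (Fin m) ℂ → ℝ) := by
  unfold frob
  fun_prop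

end Norms

/-! ### Diagonalization and existence of minimizers -/

section Minimizers

variable {N : ℕ} {H : Matrix (Fin N) (Fin N) ℂ}

/-- Unitary diagonalization with the eigenvalues in a prescribed order. -/
theorem exists_diagonalization (hH : H.IsHermitian) {ι : Type*} [Fintype ι] [DecidableEq ι]
    (σ : ι ≃ Fin N) :
    ∃ T : Matrix (Fin N) ι ℂ, Tᴴ * T = 1 ∧ T * Tᴴ = 1 ∧
      H = -(T * diagonal (fun i => ((-eigenvalueAsc hH (σ i) : ℝ) : ℂ)) * Tᴴ) := by
  let e : Fin (Fintype.card (Fin N)) ≃ Fin N := Fintype.equivOfCardEq (Fintype.card_fin _)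
  -- `eigenvalues` is `eigenvalues₀` reindexed through `e`; `τ` cancels that reindexing and reverses
  -- the order.
  let τ : ι ≃ Fin N :=
    σ.trans ((Fin.revPerm.trans (finCongr (Fintype.card_fin N).symm)).trans e)
  have hτ : ∀ i, hH.eigenvalues (τ i) = eigenvalueAsc hH (σ i) := by
    intro i
    change hH.eigenvalues₀ (e.symm (e _)) = _
    rw [e.symm_apply_apply]
    rfl
  set Q : Matrix (Fin N) (Fin N) ℂ := hH.eigenvectorUnitary.1 with hQ
  have h1 : Qᴴ * Q = 1 := Unitary.coe_star_mul_self hH.eigenvectorUnitary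
  have h2 : Q * Qᴴ = 1 := Unitary.coe_mul_star_self hH.eigenvectorUnitary
  have h3 := hH.spectral_theorem
  rw [Unitary.conjStarAlgAut_apply] at h3
  refine ⟨Q.submatrix id τ, ?_, ?_, ?_⟩
  · rw [conjTranspose_submatrix, submatrix_mul _ _ τ id τ Function.bijective_id |>.symm, h1,
      submatrix_one_equiv]
  · rw [conjTranspose_submatrix, submatrix_mul_equiv, h2, submatrix_id_id]
  · have h4 : diagonal (fun i => ((-eigenvalueAsc hH (σ i) : ℝ) : ℂ))
        = (-diagonal (RCLike.ofReal ∘ hH.eigenvalues : Fin N → ℂ)).submatrix τ τ := by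
      rw [diagonal_neg, submatrix_diagonal_equiv]
      congr 1
      ext i
      simp [← hτ]
    rw [h4, conjTranspose_submatrix, submatrix_mul_equiv, submatrix_mul_equiv, submatrix_id_id,
      Matrix.mul_neg, Matrix.neg_mul, neg_neg]
    exact h3

theorem eigenvalueAsc_neg (hH : H.IsHermitian) (hneg : (-H).PosDef) (i : Fin N) :
    eigenvalueAsc hH i < 0 := by
  obtain ⟨T, hT, hT', h⟩ := exists_diagonalization hH (Equiv.refl (Fin N))
  have hinj : Function.Injective T.mulVec := by
    intro x y hxy
    have := congrArg (Tᴴ *ᵥ ·) hxy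
    simpa [mulVec_mulVec, hT] using this
  have h1 := (hneg.conjTranspose_mul_mul_same hinj).diag_pos (i := i)
  have h2 : Tᴴ * -H * T = diagonal fun i => ((-eigenvalueAsc hH i : ℝ) : ℂ) := by
    conv_lhs => rw [h]
    rw [neg_neg, Matrix.mul_assoc, Matrix.mul_assoc, hT, Matrix.mul_one, ← Matrix.mul_assoc, hT,
      Matrix.one_mul]
    rfl
  rw [h2, diagonal_apply_eq] at h1
  have h3 : 0 < -eigenvalueAsc hH i := by exact_mod_cast h1
  linarith

theorem exists_pos_le_neg_eigenvalueAsc (hH : H.IsHermitian) (hneg : (-H).PosDef) :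
    ∃ c : ℝ, 0 < c ∧ ∀ i, c ≤ -eigenvalueAsc hH i := by
  rcases isEmpty_or_nonempty (Fin N) with h | h
  · exact ⟨1, one_pos, fun i => h.elim i⟩
  · obtain ⟨i, hi⟩ := Finite.exists_min fun i => -eigenvalueAsc hH i
    exact ⟨_, neg_pos.2 (eigenvalueAsc_neg hH hneg i), hi⟩

theorem isCompact_sublevel_E₀ (hH : H.IsHermitian) (hneg : (-H).PosDef) (m : ℕ) (r : ℝ) :
    IsCompact {X : Matrix (Fin N) (Fin m) ℂ | E₀ H X ≤ r} := by
  obtain ⟨T, hT, hT', h⟩ := exists_diagonalization hH (Equiv.refl (Fin N))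
  obtain ⟨c, hc, hca⟩ := exists_pos_le_neg_eigenvalueAsc hH hneg
  set M : ℝ := N * (2 + (r - H.trace.re) / c)
  have hcpt : IsCompact (Set.univ.pi fun _ : Fin N => Set.univ.pi fun _ : Fin m =>
      Metric.closedBall (0 : ℂ) √M) :=
    isCompact_univ_pi fun _ => isCompact_univ_pi fun _ => isCompact_closedBall _ _
  refine IsCompact.of_isClosed_subset hcpt (isClosed_le (continuous_E₀ H) continuous_const) ?_
  intro X hX i _ j _
  rw [Set.mem_ofPred_eq, E₀_eq_residual hT hT' h] at hX
  rw [mem_closedBall_zero_iff]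
  have h1 := residual_coercive hc hca (Tᴴ * X)
  rw [frobSq_isometry_mul (by rwa [conjTranspose_conjTranspose]), Fintype.card_fin] at h1
  have h2 : frobSq X ≤ M := by
    refine h1.trans (mul_le_mul_of_nonneg_left ?_ (Nat.cast_nonneg _))
    have : residual (fun i => -eigenvalueAsc hH ((Equiv.refl (Fin N)) i)) (Tᴴ * X) / c
        ≤ (r - H.trace.re) / c := div_le_div_of_nonneg_right (by linarith) hc.le
    exact add_le_add_right this 2
  have h3 : ‖X i j‖ ^ 2 ≤ frobSq X := by
    refine (Finset.single_le_sum (f := fun j => ‖X i j‖ ^ 2) (fun _ _ => sq_nonneg _)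
      (Finset.mem_univ j)).trans ?_
    exact Finset.single_le_sum (f := fun i => ∑ j, ‖X i j‖ ^ 2)
      (fun _ _ => Finset.sum_nonneg fun _ _ => sq_nonneg _) (Finset.mem_univ i)
  exact Real.le_sqrt_of_sq_le (h3.trans h2)

/-- Minimize over the compact set where `E₀ H X ≤ f 0`, which contains `0`; off it, `f` already
exceeds `f 0`. Serves both `E₀` and `E H μ`. -/
theorem exists_global_min (hH : H.IsHermitian) (hneg : (-H).PosDef) {m : ℕ}
    {f : Matrix (Fin N) (Fin m) ℂ → ℝ} (hf : Continuous f) (hle : ∀ X, E₀ H X ≤ f X) :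
    ∃ X₀, ∀ X, f X₀ ≤ f X := by
  have hmem : (0 : Matrix (Fin N) (Fin m) ℂ) ∈ {X | E₀ H X ≤ f 0} := hle 0
  obtain ⟨X₀, _, hmin⟩ := (isCompact_sublevel_E₀ hH hneg m (f 0)).exists_isMinOn ⟨0, hmem⟩
    hf.continuousOn
  refine ⟨X₀, fun X => ?_⟩
  by_cases hX : E₀ H X ≤ f 0
  · exact hmin hX
  · have h1 : f X₀ ≤ f 0 := hmin hmem
    linarith [hle X, not_le.1 hX]

theorem mem_S₀_iff {m : ℕ} {X : Matrix (Fin N) (Fin m) ℂ} :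
    X ∈ S₀ m H ↔ ∀ Y : Matrix (Fin N) (Fin m) ℂ, E₀ H X ≤ E₀ H Y := by
  simp [S₀, argminOn, isMinOn_iff]

theorem mem_S_iff {m : ℕ} {μ : ℝ} {X : Matrix (Fin N) (Fin m) ℂ} :
    X ∈ S m H μ ↔ ∀ Y : Matrix (Fin N) (Fin m) ℂ, E H μ X ≤ E H μ Y := by
  simp [S, argminOn, isMinOn_iff]

theorem S₀_nonempty (hH : H.IsHermitian) (hneg : (-H).PosDef) (m : ℕ) : (S₀ m H).Nonempty := by
  obtain ⟨X₀, h⟩ := exists_global_min hH hneg (continuous_E₀ (m := m) H) fun _ => le_rfl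
  exact ⟨X₀, mem_S₀_iff.2 h⟩

theorem isCompact_S₀ (hH : H.IsHermitian) (hneg : (-H).PosDef) (m : ℕ) :
    IsCompact (S₀ m H) := by
  obtain ⟨X₀, hX₀⟩ := S₀_nonempty hH hneg m
  have : S₀ m H = {X | E₀ H X ≤ E₀ H X₀} := by
    ext X
    rw [mem_S₀_iff]
    exact ⟨fun h => h X₀, fun h Y => le_trans h (mem_S₀_iff.1 hX₀ Y)⟩
  rw [this]
  exact isCompact_sublevel_E₀ hH hneg m _

theorem nearest_nonempty (hH : H.IsHermitian) (hneg : (-H).PosDef) {m : ℕ}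
    (X : Matrix (Fin N) (Fin m) ℂ) : (nearest H X).Nonempty := by
  have hsub : Continuous fun G : Matrix (Fin N) (Fin m) ℂ => X - G := by fun_prop
  have hcont : Continuous fun G : Matrix (Fin N) (Fin m) ℂ => frob (X - G) :=
    Continuous.comp (g := frob) continuous_frob hsub
  obtain ⟨G, hG, hmin⟩ := (isCompact_S₀ hH hneg m).exists_isMinOn (S₀_nonempty hH hneg m)
    hcont.continuousOn
  exact ⟨G, hG, hmin⟩

theorem min_E_sub_min_E₀_le (hH : H.IsHermitian) (hneg : (-H).PosDef) (m : ℕ) {μ : ℝ}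
    (hμ : 0 < μ) : ∃ minEμ minE₀ minl1 : ℝ,
      IsLeast (Set.range fun X : Matrix (Fin N) (Fin m) ℂ => E H μ X) minEμ ∧
      IsLeast (Set.range fun X : Matrix (Fin N) (Fin m) ℂ => E₀ H X) minE₀ ∧
      IsLeast (l1 '' S₀ m H) minl1 ∧
      minEμ - minE₀ ≤ μ * minl1 := by
  obtain ⟨Y, hY⟩ := exists_global_min hH hneg (m := m) (f := E H μ)
    ((continuous_E₀ H).add (continuous_const.mul continuous_l1))
    fun X => le_add_of_nonneg_right (mul_nonneg hμ.le (l1_nonneg X))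
  obtain ⟨G, hG, hmin⟩ := (isCompact_S₀ hH hneg m).exists_isMinOn (S₀_nonempty hH hneg m)
    continuous_l1.continuousOn
  refine ⟨E H μ Y, E₀ H G, l1 G, ⟨⟨Y, rfl⟩, ?_⟩, ⟨⟨G, rfl⟩, ?_⟩, ⟨⟨G, hG, rfl⟩, ?_⟩, ?_⟩
  · rintro _ ⟨X, rfl⟩
    exact hY X
  · rintro _ ⟨X, rfl⟩
    exact mem_S₀_iff.1 hG X
  · rintro _ ⟨X, hX, rfl⟩
    exact hmin hX
  · have := hY G
    rw [E.eq_1 H μ G] at this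
    linarith

end Minimizers

/-! ### Quadratic growth of the energy -/

/-- Quadratic growth of `E₀` near its set of minimizers. -/
theorem exists_E₀_quadratic_growth {N m : ℕ} {H : Matrix (Fin N) (Fin N) ℂ}
    (hH : H.IsHermitian) (hneg : (-H).PosDef) {α : ℝ} (hα : α ∈ Set.Ioo (0 : ℝ) 1)
    {k l : Fin N} (hk : k.val + 1 = m) (hl : l.val = m)
    (hgap : eigenvalueAsc hH k < eigenvalueAsc hH l) :
    ∃ δ₀ : ℝ, 0 < δ₀ ∧ ∀ X₀ ∈ S₀ m H, ∀ X : Matrix (Fin N) (Fin m) ℂ,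
      E₀ H X - E₀ H X₀ < δ₀ → ∃ G ∈ S₀ m H,
        α * (eigenvalueAsc hH l - eigenvalueAsc hH k) * frobSq (X - G)
          ≤ E₀ H X - E₀ H X₀ := by
  obtain ⟨n, rfl⟩ : ∃ n, N = m + n := ⟨N - m, by have := l.2; omega⟩
  obtain ⟨c, hc, hca⟩ := exists_pos_le_neg_eigenvalueAsc hH hneg
  obtain ⟨T, hT, hT', h⟩ := exists_diagonalization hH (finSumFinEquiv (m := m) (n := n))
  set a : Fin m → ℝ := fun i => -eigenvalueAsc hH (Fin.castAdd n i) with ha_def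
  set b : Fin n → ℝ := fun i => -eigenvalueAsc hH (Fin.natAdd m i) with hb_def
  have hab : (fun i => ((-eigenvalueAsc hH (finSumFinEquiv i) : ℝ) : ℂ))
      = fun i => ((Sum.elim a b i : ℝ) : ℂ) := by
    ext i
    cases i <;> simp [ha_def, hb_def]
  rw [hab] at h
  have hE := fun X : Matrix (Fin (m + n)) (Fin m) ℂ => E₀_eq_residual hT hT' h X
  -- The indices `k` and `l` are `m - 1` and `m` counted from zero, so `d` is the least leading
  -- weight and `e` the greatest trailing one.
  set d : ℝ := -eigenvalueAsc hH k with hd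
  set e : ℝ := -eigenvalueAsc hH l with he
  have hg : eigenvalueAsc hH l - eigenvalueAsc hH k = d - e := by
    rw [hd, he]; ring
  rw [hg]
  have hed : e < d := neg_lt_neg hgap
  have he0 : 0 < e := neg_pos.2 (eigenvalueAsc_neg hH hneg _)
  have ha : ∀ i, d ≤ a i := fun i => neg_le_neg (eigenvalueAsc_monotone hH
    (Fin.le_def.2 (by have := i.2; simp only [Fin.val_castAdd]; omega)))
  have hb : ∀ i, b i ≤ e := fun i => neg_le_neg (eigenvalueAsc_monotone hH
    (Fin.le_def.2 (by simp only [Fin.val_natAdd]; omega)))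
  have hb0 : ∀ i, 0 ≤ b i := fun i => hc.le.trans (hca _)
  have hsplit : ∀ X : Matrix (Fin (m + n)) (Fin m) ℂ,
      Tᴴ * X = fromRows (Tᴴ * X).toRows₁ (Tᴴ * X).toRows₂ := fun X => (fromRows_toRows _).symm
  have hlow := fun (C : Matrix (Fin m) (Fin m) ℂ) (B : Matrix (Fin n) (Fin m) ℂ) =>
    residual_lower_bound hc he0.le hed ha hb (fun i => hca _) (fun i => hca _) C B
  have hU : ∀ U : Matrix (Fin m) (Fin m) ℂ, U * Uᴴ = 1 →
      E₀ H (T * fromRows U (0 : Matrix (Fin n) (Fin m) ℂ)) = H.trace.re + ∑ j, b j := by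
    intro U hU
    rw [hE, ← Matrix.mul_assoc, hT, Matrix.one_mul, residual_unitary _ _ hU]
  have hge : ∀ X : Matrix (Fin (m + n)) (Fin m) ℂ, H.trace.re + ∑ j, b j ≤ E₀ H X := by
    intro X
    rw [hE, hsplit X]
    linarith [(hlow (Tᴴ * X).toRows₁ (Tᴴ * X).toRows₂).1]
  have hUS : ∀ U : Matrix (Fin m) (Fin m) ℂ, U * Uᴴ = 1 → T * fromRows U (0 : Matrix (Fin n) (Fin m) ℂ) ∈ S₀ m H :=
    fun U h => mem_S₀_iff.2 fun Y => (hU U h).le.trans (hge Y)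
  set K : ℝ := 2 * (1 / (d - e) + 1 / c) with hK
  have hde : 0 < d - e := sub_pos.2 hed
  have hKpos : 0 < K := by positivity
  -- For `η < ε`, the bound `1` makes the polar factor available, and the other bound keeps the
  -- coefficient `(d - e) - η * (d + e)` at least `α * (d - e)`.
  set ε : ℝ := min 1 ((1 - α) * (d - e) / (d + e)) with hε
  have hεpos : 0 < ε := lt_min one_pos
    (div_pos (mul_pos (sub_pos.2 hα.2) hde) (by linarith))
  -- `K` is the constant of `residual_lower_bound`, so an excess below `ε ^ 2 / K` forces `η < ε`.
  refine ⟨ε ^ 2 / K, by positivity, fun X₀ hX₀ X hX => ?_⟩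
  have hmin : E₀ H X₀ = H.trace.re + ∑ j, b j :=
    le_antisymm ((mem_S₀_iff.1 hX₀ _).trans (hU 1 (by simp)).le) (hge X₀)
  set C := (Tᴴ * X).toRows₁ with hC
  set B := (Tᴴ * X).toRows₂ with hB
  have hEX : E₀ H X - E₀ H X₀ = residual (Sum.elim a b) (fromRows C B) - ∑ j, b j := by
    rw [hmin, hE, hsplit X]; ring
  have hη := (hlow C B).2
  rw [← hEX] at hη
  have hη1 : frobSq (1 - Cᴴ * C) < ε ^ 2 := by
    refine hη.trans_lt ?_
    rwa [lt_div_iff₀ hKpos, mul_comm] at hX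
  set η := √(frobSq (1 - Cᴴ * C)) with hηdef
  have hη0 : 0 ≤ η := Real.sqrt_nonneg _
  have hηsq : η ^ 2 = frobSq (1 - Cᴴ * C) := Real.sq_sqrt (frobSq_nonneg _)
  have hηε : η < ε := lt_of_pow_lt_pow_left₀ 2 hεpos.le (by rwa [hηsq])
  obtain ⟨U, hUU, hCU⟩ := exists_unitary_near C
    (by rw [← hηsq]; nlinarith [min_le_left 1 ((1 - α) * (d - e) / (d + e))])
  refine ⟨T * fromRows U (0 : Matrix (Fin n) (Fin m) ℂ), hUS U hUU, ?_⟩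
  have hdist : frobSq (X - T * fromRows U (0 : Matrix (Fin n) (Fin m) ℂ))
      = frobSq (C - U) + frobSq B := by
    rw [← frobSq_isometry_mul (T := Tᴴ) (by rwa [conjTranspose_conjTranspose]), Matrix.mul_sub,
      ← Matrix.mul_assoc, hT, Matrix.one_mul, hsplit X, ← hC, ← hB,
      ← frobSq_fromRows]
    congr 1
    ext i j
    cases i <;> simp
  have hgrow := residual_quadratic_growth (he0.le.trans hed.le) ha hb hb0 C B hηdef.symm
  rw [hdist, hEX]
  have h1 : η * (d + e) ≤ (1 - α) * (d - e) := by
    rw [← le_div_iff₀ (by linarith)]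
    exact hηε.le.trans (min_le_right _ _)
  have h2 : α * (d - e) * frobSq (C - U) ≤ d * η ^ 2 := by
    rw [hηsq]
    refine mul_le_mul ?_ hCU (frobSq_nonneg _) (by linarith)
    nlinarith [hα.1, hα.2]
  have h3 : α * (d - e) * frobSq B ≤ ((d - e) - η * (d + e)) * frobSq B :=
    mul_le_mul_of_nonneg_right (by linarith) (frobSq_nonneg _)
  linarith

end OMM

/-! ### The main estimate -/

theorem corollary2p9 {N m : ℕ} (H : Matrix (Fin N) (Fin N) ℂ) (hH : H.IsHermitian)
    (hneg : (-H).PosDef) (α : ℝ) (hα : α ∈ Set.Ioo (0 : ℝ) 1) :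
    (∀ μ : ℝ, 0 < μ → ∃ minEμ minE₀ minl1 : ℝ,
      IsLeast (Set.range fun X : Matrix (Fin N) (Fin m) ℂ => OMM.E H μ X) minEμ ∧
      IsLeast (Set.range fun X : Matrix (Fin N) (Fin m) ℂ => OMM.E₀ H X) minE₀ ∧
      IsLeast (OMM.l1 '' OMM.S₀ m H) minl1 ∧
      minEμ - minE₀ ≤ μ * minl1) ∧
    (∀ (hm : 1 ≤ m) (hmN : m < N) (lam_m lam_m1 : ℝ),
      lam_m = OMM.eigenvalueAsc hH ⟨m - 1, by omega⟩ →
      lam_m1 = OMM.eigenvalueAsc hH ⟨m, hmN⟩ →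
      lam_m < lam_m1 →
      ∃ μ₀ : ℝ, 0 < μ₀ ∧ ∀ μ : ℝ, 0 < μ → μ < μ₀ → ∀ Xμ ∈ OMM.S m H μ,
        ∃ (minE₀ : ℝ) (k : ℕ),
          IsLeast (Set.range fun X : Matrix (Fin N) (Fin m) ℂ => OMM.E₀ H X) minE₀ ∧
          IsLeast ((fun X₀ => OMM.l0 (X₀ - Xμ)) '' OMM.nearest H Xμ) k ∧
          OMM.E₀ H Xμ - minE₀ ≤ μ ^ 2 / (α * (lam_m1 - lam_m)) * (k : ℝ) ∧
          OMM.E₀ H Xμ - minE₀ ≤ μ ^ 2 / (α * (lam_m1 - lam_m)) * (k : ℝ) ^ 2 ∧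
          μ ^ 2 / (α * (lam_m1 - lam_m)) * (k : ℝ) ≤
            μ ^ 2 * (N : ℝ) * (m : ℝ) / (α * (lam_m1 - lam_m)) ∧
          OMM.E₀ H Xμ - minE₀ ≤ μ ^ 2 * (N : ℝ) * (m : ℝ) / (α * (lam_m1 - lam_m))) := by
  open OMM in
  refine ⟨fun μ hμ => min_E_sub_min_E₀_le hH hneg m hμ, ?_⟩
  rintro hm hmN _ _ rfl rfl hgap
  obtain ⟨δ₀, hδ₀, hgrow⟩ := exists_E₀_quadratic_growth hH hneg hα (Nat.sub_add_cancel hm) rfl hgap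
  set g := α * (eigenvalueAsc hH ⟨m, hmN⟩ - eigenvalueAsc hH ⟨m - 1, by omega⟩) with hg
  have hgpos : 0 < g := mul_pos hα.1 (sub_pos.2 hgap)
  obtain ⟨Z, hZ⟩ := S₀_nonempty hH hneg m
  have hL := l1_nonneg Z
  -- The excess of `Xμ` is at most `μ * l1 Z`, which this choice keeps below `δ₀`; the `+ 1` covers
  -- `l1 Z = 0`.
  refine ⟨δ₀ / (l1 Z + 1), by positivity, fun μ hμ hμ₀ Xμ hXμ => ?_⟩
  have hmin : ∀ G ∈ S₀ m H, E₀ H Xμ - E₀ H Z ≤ μ * (l1 G - l1 Xμ) := by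
    intro G hG
    have h1 := mem_S_iff.1 hXμ G
    have h2 := mem_S₀_iff.1 hG Z
    simp only [E] at h1
    linarith
  have hne : ((fun X₀ => l0 (X₀ - Xμ)) '' nearest H Xμ).Nonempty :=
    (nearest_nonempty hH hneg Xμ).image _
  obtain ⟨X₀, hX₀, hk⟩ := Nat.sInf_mem hne
  set k := sInf ((fun X₀ => l0 (X₀ - Xμ)) '' nearest H Xμ) with hkdef
  dsimp only at hk
  have hsmall : E₀ H Xμ - E₀ H Z < δ₀ := by
    rw [lt_div_iff₀ (by linarith)] at hμ₀
    nlinarith [hmin Z hZ, mul_nonneg hμ.le (l1_nonneg Xμ)]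
  obtain ⟨G, hG, hGle⟩ := hgrow Z hZ Xμ hsmall
  set δ := E₀ H Xμ - E₀ H Z with hδ
  have hδ0 : 0 ≤ δ := sub_nonneg.2 (mem_S₀_iff.1 hZ Xμ)
  -- Quadratic growth supplies some `G` in `S₀`; every nearest point is at least as close.
  have hdist : frobSq (X₀ - Xμ) ≤ δ / g := by
    have h1 : frob (Xμ - X₀) ≤ frob (Xμ - G) := hX₀.2 hG
    rw [frob_eq_sqrt, frob_eq_sqrt, Real.sqrt_le_sqrt_iff (frobSq_nonneg _)] at h1
    have h2 : frobSq (X₀ - Xμ) = frobSq (Xμ - X₀) := by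
      simp only [frobSq, Matrix.sub_apply, norm_sub_rev]
    rw [le_div_iff₀ hgpos, h2, mul_comm]
    exact (mul_le_mul_of_nonneg_left h1 hgpos.le).trans hGle
  have hmain : δ ≤ μ ^ 2 / g * k := by
    have h1 : δ ≤ μ * l1 (X₀ - Xμ) :=
      (hmin X₀ hX₀.1).trans (mul_le_mul_of_nonneg_left (l1_sub_le _ _) hμ.le)
    have h2 := l1_sq_le (X₀ - Xμ)
    rw [hk] at h2
    have h3 : l1 (X₀ - Xμ) ^ 2 ≤ k * (δ / g) :=
      h2.trans (mul_le_mul_of_nonneg_left hdist (Nat.cast_nonneg _))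
    have h4 : δ * δ ≤ (μ ^ 2 / g * k) * δ := by
      calc δ * δ ≤ (μ * l1 (X₀ - Xμ)) * (μ * l1 (X₀ - Xμ)) :=
            mul_le_mul h1 h1 hδ0 (hδ0.trans h1)
        _ = μ ^ 2 * l1 (X₀ - Xμ) ^ 2 := by ring
        _ ≤ μ ^ 2 * (k * (δ / g)) := mul_le_mul_of_nonneg_left h3 (sq_nonneg _)
        _ = _ := by ring
    -- Cancelling `δ` in `h4` needs `δ > 0`; for `δ = 0` the bound is immediate.
    rcases hδ0.eq_or_lt with h0 | h0
    · rw [← h0]; positivity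
    · exact le_of_mul_le_mul_right h4 h0
  have hkle : μ ^ 2 / g * k ≤ μ ^ 2 * N * m / g := by
    have h1 : (k : ℝ) ≤ N * m := by exact_mod_cast hk ▸ l0_le (X₀ - Xμ)
    calc μ ^ 2 / g * k ≤ μ ^ 2 / g * (N * m) := mul_le_mul_of_nonneg_left h1 (by positivity)
      _ = _ := by ring
  refine ⟨E₀ H Z, k, ⟨⟨Z, rfl⟩, ?_⟩, ⟨⟨X₀, hX₀, hk⟩, fun _ h => Nat.sInf_le h⟩, hmain,
    hmain.trans (mul_le_mul_of_nonneg_left ?_ (by positivity)), hkle, hmain.trans hkle⟩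
  · rintro _ ⟨X, rfl⟩
    exact mem_S₀_iff.1 hZ X
  · exact_mod_cast Nat.le_self_pow two_ne_zero k
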